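/- Conventions. A *bounded trace* on a (possibly non-unital) C*-algebra $D$ is a bounded positive linear functional $\tau$ on $D$ with $\tau(x^*x)=\tau(xx^*)$ for all $x\in D$; it is *faithful* if $\tau(x^*x)=0$ implies $x=0$. We say that $D$ *admits a faithful trace* if it has a faithful bounded trace of norm one (for unital $D$: a faithful tracial state). Ideals are closed and two-sided; an ideal $I$ of $A$ is *essential* if $I\cap J\neq 0$ for every non-zero ideal $J$ of $A$. $\mathcal M(I)$ denotes the multiplier algebra. Morita equivalence means strong (Rieffel) Morita equivalence, i.e. the existence of an $A$-$B$-imprimitivity bimodule. $A\otimes B$ is the minimal (spatial) tensor product: for faithful unital representations of $A$ on $H$ and of $B$ on $K$, it is the C*-subalgebra of $B(H\otimes K)$ generated by the operators $a\otimes b$, $a\in A$, $b\in B$. **Proposition.** Let $A$ and $B$ be unital C*-algebras. (i) If $A$ and $B$ are Morita equivalent and $A$ admits a faithful trace, then so does $B$. (ii) The minimal tensor product $A\otimes B$ admits a faithful trace if and only if both $A$ and $B$ do. (iii) If $A\neq 0$, $I$ is an essential ideal of $A$, and $I$ has a faithful bounded trace, then $A$ admits a faithful trace. In particular, a (possibly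 non-unital) C*-algebra $I$ admits a faithful trace if and only if $\mathcal M(I)$ does. (iv) If $I$ is an ideal of $A$ such that both $I$ and $A/I$ admit a faithful trace, then $A$ admits a faithful trace. -/

import Mathlib

open scoped TensorProduct MultiplierAlgebra

/-! ### Traces -/

namespace CStarTrace

/-- A bounded positive linear functional `τ` on a (possibly non-unital) C⋆-algebra `A` with
`τ (x* x) = τ (x x*)` for all `x`. Positivity says that `τ (x* x)` is real
and nonnegative. -/
structure IsBoundedTrace {A : Type*} [NonUnitalCStarAlgebra A] (τ : A →L[ℂ] ℂ) : Prop where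
  re_nonneg : ∀ x : A, 0 ≤ (τ (star x * x)).re
  im_eq_zero : ∀ x : A, (τ (star x * x)).im = 0
  trace : ∀ x : A, τ (star x * x) = τ (x * star x)

/-- A tracial state: a positive trace of norm one. On a unital C⋆-algebra this is a positive trace
taking the value `1` at the unit. -/
structure IsTracialState {A : Type*} [NonUnitalCStarAlgebra A] (τ : A →L[ℂ] ℂ) : Prop
    extends IsBoundedTrace τ where
  norm_eq_one : ‖τ‖ = 1

/-- `τ` is faithful if `τ (x* x) = 0` only for `x = 0`. -/
def IsFaithful {A : Type*} [NonUnitalCStarAlgebra A] (τ : A →L[ℂ] ℂ) : Prop :=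
  ∀ x : A, τ (star x * x) = 0 → x = 0

/-- `A` admits a faithful trace, that is, a faithful tracial state. -/
def HasFaithfulTrace (A : Type*) [NonUnitalCStarAlgebra A] : Prop :=
  ∃ τ : A →L[ℂ] ℂ, IsTracialState τ ∧ IsFaithful τ

/-- `A` admits a faithful bounded positive trace (of arbitrary norm). -/
def HasFaithfulBoundedTrace (A : Type*) [NonUnitalCStarAlgebra A] : Prop :=
  ∃ τ : A →L[ℂ] ℂ, IsBoundedTrace τ ∧ IsFaithful τ

end CStarTrace

/-! ### Morita equivalence -/

namespace CStarTrace

/-- An `A`-`B`-imprimitivity bimodule structure on `X`: `X` is an `A`-`B`-bimodule (the right action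
of `B` being written as an action of `Bᵐᵒᵖ`), with an `A`-valued inner product `inA`, linear in the
first variable, and a `B`-valued inner product `inB`, linear in the second variable, which make it a
full left Hilbert `A`-module and a full right Hilbert `B`-module, such that each algebra acts by
adjointable operators for the other inner product and `⟨x, y⟩_A z = x ⟨y, z⟩_B`.
In a C⋆-algebra the positive elements are exactly those of the form `a* a`. -/
structure ImprimitivityBimodule (A B X : Type*) [CStarAlgebra A] [CStarAlgebra B]
    [NormedAddCommGroup X] [NormedSpace ℂ X] [CompleteSpace X] [Module A X] [Module Bᵐᵒᵖ X]
    [IsScalarTower ℂ A X] [IsScalarTower ℂ Bᵐᵒᵖ X] [SMulCommClass A Bᵐᵒᵖ X] where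
  /-- the `A`-valued inner product -/
  inA : X → X → A
  inA_add_left : ∀ x y z, inA (x + y) z = inA x z + inA y z
  inA_smul_left : ∀ (a : A) x y, inA (a • x) y = a * inA x y
  star_inA : ∀ x y, star (inA x y) = inA y x
  inA_self_nonneg : ∀ x, ∃ a : A, inA x x = star a * a
  norm_sq_eq_inA : ∀ x, ‖x‖ ^ 2 = ‖inA x x‖
  full_inA : Dense (Submodule.span ℂ {a : A | ∃ x y, a = inA x y} : Set A)
  /-- the `B`-valued inner product -/
  inB : X → X → B
  inB_add_right : ∀ x y z, inB x (y + z) = inB x y + inB x z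
  inB_smul_right : ∀ (b : B) x y, inB x (MulOpposite.op b • y) = inB x y * b
  star_inB : ∀ x y, star (inB x y) = inB y x
  inB_self_nonneg : ∀ x, ∃ b : B, inB x x = star b * b
  norm_sq_eq_inB : ∀ x, ‖x‖ ^ 2 = ‖inB x x‖
  full_inB : Dense (Submodule.span ℂ {b : B | ∃ x y, b = inB x y} : Set B)
  inB_adjoint : ∀ (a : A) x y, inB (a • x) y = inB x (star a • y)
  inA_adjoint : ∀ (b : B) x y,
    inA (MulOpposite.op b • x) y = inA x (MulOpposite.op (star b) • y)
  inA_smul_eq_smul_inB : ∀ x y z, inA x y • z = MulOpposite.op (inB y z) • x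

universe u v w

/-- (Strong) Morita equivalence of C⋆-algebras: there is an imprimitivity bimodule. -/
def MoritaEquivalent (A : Type u) (B : Type v) [CStarAlgebra A] [CStarAlgebra B] : Prop :=
  ∃ (X : Type w) (_ : NormedAddCommGroup X) (_ : NormedSpace ℂ X) (_ : CompleteSpace X)
    (_ : Module A X) (_ : Module Bᵐᵒᵖ X) (_ : IsScalarTower ℂ A X) (_ : IsScalarTower ℂ Bᵐᵒᵖ X)
    (_ : SMulCommClass A Bᵐᵒᵖ X), Nonempty (ImprimitivityBimodule A B X)

end CStarTrace

/-! ### The minimal tensor product -/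

namespace CStarTrace

section MinTensor

variable {A B H K : Type*} [CStarAlgebra A] [CStarAlgebra B]
  [NormedAddCommGroup H] [InnerProductSpace ℂ H]
  [NormedAddCommGroup K] [InnerProductSpace ℂ K]

/-- The Hilbert space tensor product of `H` and `K`: the completion of the algebraic one. -/
def HilbertTensor (H K : Type*) [NormedAddCommGroup H] [InnerProductSpace ℂ H]
    [NormedAddCommGroup K] [InnerProductSpace ℂ K] : Type _ :=
  UniformSpace.Completion (H ⊗[ℂ] K)

noncomputable instance (H K : Type*) [NormedAddCommGroup H] [InnerProductSpace ℂ H]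
    [NormedAddCommGroup K] [InnerProductSpace ℂ K] : NormedAddCommGroup (HilbertTensor H K) :=
  inferInstanceAs (NormedAddCommGroup (UniformSpace.Completion (H ⊗[ℂ] K)))

noncomputable instance (H K : Type*) [NormedAddCommGroup H] [InnerProductSpace ℂ H]
    [NormedAddCommGroup K] [InnerProductSpace ℂ K] : InnerProductSpace ℂ (HilbertTensor H K) :=
  inferInstanceAs (InnerProductSpace ℂ (UniformSpace.Completion (H ⊗[ℂ] K)))

instance (H K : Type*) [NormedAddCommGroup H] [InnerProductSpace ℂ H]
    [NormedAddCommGroup K] [InnerProductSpace ℂ K] : CompleteSpace (HilbertTensor H K) :=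
  inferInstanceAs (CompleteSpace (UniformSpace.Completion (H ⊗[ℂ] K)))

/-- The operator `S ⊗ T` on the Hilbert space tensor product. -/
noncomputable def opTensor (S : H →L[ℂ] H) (T : K →L[ℂ] K) :
    HilbertTensor H K →L[ℂ] HilbertTensor H K :=
  (TensorProduct.mapL S T).completion

/-- The elementary tensor `x ⊗ y` in the Hilbert space tensor product. -/
noncomputable def HilbertTensor.tmul (x : H) (y : K) : HilbertTensor H K :=
  ((x ⊗ₜ[ℂ] y : H ⊗[ℂ] K) : UniformSpace.Completion (H ⊗[ℂ] K))

theorem opTensor_tmul (S : H →L[ℂ] H) (T : K →L[ℂ] K) (x : H) (y : K) :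
    opTensor S T (HilbertTensor.tmul x y) = HilbertTensor.tmul (S x) (T y) :=
  ContinuousLinearMap.completion_apply_coe (TensorProduct.mapL S T) (x ⊗ₜ[ℂ] y)

variable [CompleteSpace H] [CompleteSpace K]

/-- The minimal (spatial) tensor product of `A` and `B`, realized in faithful representations `π` of
`A` on `H` and `σ` of `B` on `K`: the C⋆-algebra of operators on the Hilbert space tensor product
generated by the operators `π a ⊗ σ b`. Up to an isomorphism fixing the elementary tensors it does
not depend on the faithful representations. -/
noncomputable def minTensor (π : A →⋆ₐ[ℂ] (H →L[ℂ] H)) (σ : B →⋆ₐ[ℂ] (K →L[ℂ] K)) :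
    StarSubalgebra ℂ (HilbertTensor H K →L[ℂ] HilbertTensor H K) :=
  (StarAlgebra.adjoin ℂ
    {T : HilbertTensor H K →L[ℂ] HilbertTensor H K |
      ∃ (a : A) (b : B), T = opTensor (π a) (σ b)}).topologicalClosure

instance isClosed_minTensor (π : A →⋆ₐ[ℂ] (H →L[ℂ] H)) (σ : B →⋆ₐ[ℂ] (K →L[ℂ] K)) :
    IsClosed (minTensor π σ : Set (HilbertTensor H K →L[ℂ] HilbertTensor H K)) :=
  StarSubalgebra.isClosed_topologicalClosure _

end MinTensor

end CStarTrace

/-! ### Closed two-sided ideals and quotients -/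

namespace CStarTrace

section Ideals

variable {A : Type*} [CStarAlgebra A]

/-- Approximate units of closed ideals, for one element. -/
theorem exists_approx (I : Ideal A) [I.IsTwoSided] {x : A} (hx : x ∈ I) {ε : ℝ} (hε : 0 < ε) :
    ∃ e ∈ I, IsSelfAdjoint e ∧ ‖1 - e‖ ≤ 1 ∧ ‖x * (1 - e)‖ ≤ ε := by
  set h : A := star x * x with hh
  have hsa : IsSelfAdjoint h := IsSelfAdjoint.star_mul_self x
  have hI : h ∈ I := I.mul_mem_left _ hx
  set δ : ℝ := ε ^ 2 with hδ
  have hδ0 : 0 < δ := by positivity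
  have hpos : ∀ t : ℝ, 0 < |t| + δ := fun t => by positivity
  have hg : Continuous fun t : ℝ => (|t| + δ)⁻¹ :=
    Continuous.inv₀ (by fun_prop) fun t => (hpos t).ne'
  have hk : Continuous fun t : ℝ => 1 - t * (|t| + δ)⁻¹ := by fun_prop
  have he : cfc (fun t : ℝ => t * (|t| + δ)⁻¹) h = cfc (fun t : ℝ => (|t| + δ)⁻¹) h * h := by
    have h1 := cfc_mul (fun t : ℝ => (|t| + δ)⁻¹) (fun t : ℝ => t) h hg.continuousOn
      continuousOn_id
    rw [cfc_id' ℝ h] at h1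
    rw [← h1]
    exact cfc_congr fun t _ => mul_comm _ _
  have h1e : 1 - cfc (fun t : ℝ => t * (|t| + δ)⁻¹) h
      = cfc (fun t : ℝ => 1 - t * (|t| + δ)⁻¹) h := by
    rw [cfc_sub (fun _ : ℝ => (1 : ℝ)) (fun t : ℝ => t * (|t| + δ)⁻¹) h (by fun_prop)
      (by fun_prop), cfc_const_one ℝ h]
  have hspec : ∀ t ∈ spectrum ℝ h, 0 ≤ t := by
    let _ := CStarAlgebra.spectralOrder A
    have := CStarAlgebra.spectralOrderedRing A
    intro t ht
    exact spectrum_nonneg_of_nonneg (star_mul_self_nonneg x) ht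
  have hk1 : ∀ t : ℝ, 0 ≤ t → 1 - t * (|t| + δ)⁻¹ = δ * (t + δ)⁻¹ := fun t ht => by
    have := hpos t
    rw [abs_of_nonneg ht] at this ⊢
    field_simp
    ring
  refine ⟨cfc (fun t : ℝ => t * (|t| + δ)⁻¹) h, ?_, cfc_predicate _ _, ?_, ?_⟩
  · rw [he]
    exact I.mul_mem_left _ hI
  · rw [h1e]
    refine norm_cfc_le zero_le_one fun t ht => ?_
    have ht0 := hspec t ht
    rw [hk1 t ht0, Real.norm_of_nonneg (by positivity), ← div_eq_mul_inv,
      div_le_one (by positivity)]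
    linarith
  · have hs : star (1 - cfc (fun t : ℝ => t * (|t| + δ)⁻¹) h)
        = cfc (fun t : ℝ => 1 - t * (|t| + δ)⁻¹) h := by
      rw [h1e]
      exact (cfc_predicate (R := ℝ) (p := IsSelfAdjoint) (fun t : ℝ => 1 - t * (|t| + δ)⁻¹) h)
    have hsq : ‖x * (1 - cfc (fun t : ℝ => t * (|t| + δ)⁻¹) h)‖ ^ 2 ≤ ε ^ 2 := by
      rw [sq, ← CStarRing.norm_star_mul_self, star_mul, hs, h1e, mul_assoc, ← mul_assoc (star x),
        ← hh]
      have hm1 := cfc_mul (fun t : ℝ => t) (fun t : ℝ => 1 - t * (|t| + δ)⁻¹) h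
        continuousOn_id hk.continuousOn
      have hm2 := cfc_mul (fun t : ℝ => 1 - t * (|t| + δ)⁻¹)
        (fun t : ℝ => t * (1 - t * (|t| + δ)⁻¹)) h hk.continuousOn (by fun_prop)
      rw [cfc_id' ℝ h] at hm1
      rw [hm1] at hm2
      rw [← hm2]
      refine norm_cfc_le (by positivity) fun t ht => ?_
      have ht0 := hspec t ht
      have htd : 0 < t + δ := by positivity
      rw [hk1 t ht0, Real.norm_of_nonneg (by positivity), ← hδ]
      have : δ * (t + δ)⁻¹ * (t * (δ * (t + δ)⁻¹)) = δ * (δ * t / (t + δ) ^ 2) := by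
        field_simp
      rw [this]
      refine mul_le_of_le_one_right hδ0.le ?_
      rw [div_le_one (by positivity)]
      nlinarith [sq_nonneg t, sq_nonneg δ, mul_nonneg ht0 hδ0.le]
    exact (sq_le_sq₀ (norm_nonneg _) hε.le).1 hsq

/-- Closed two-sided ideals are self-adjoint. -/
theorem star_mem_ideal (I : Ideal A) [I.IsTwoSided] [hI : IsClosed (I : Set A)] {x : A}
    (hx : x ∈ I) : star x ∈ I := by
  have : star x ∈ closure (I : Set A) := by
    refine Metric.mem_closure_iff.2 fun ε hε => ?_
    obtain ⟨e, heI, hesa, -, hle⟩ := exists_approx I hx (half_pos hε)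
    refine ⟨e * star x, I.mul_mem_right _ heI, ?_⟩
    rw [dist_eq_norm]
    have : star x - e * star x = star (x * (1 - e)) := by
      rw [star_mul, star_sub, star_one, hesa.star_eq, sub_mul, one_mul]
    rw [this, norm_star]
    linarith
  rwa [hI.closure_eq] at this

/-- A closed two-sided ideal, as a closed ⋆-subalgebra; in particular it is a C⋆-algebra. -/
def idealAlgebra (I : Ideal A) [I.IsTwoSided] [IsClosed (I : Set A)] :
    NonUnitalStarSubalgebra ℂ A where
  carrier := I
  add_mem' := I.add_mem
  zero_mem' := I.zero_mem
  mul_mem' := fun _ hb => I.mul_mem_left _ hb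
  smul_mem' := fun c x hx => by
    have : c • x = (algebraMap ℂ A c) * x := Algebra.smul_def c x
    rw [this]
    exact I.mul_mem_left _ hx
  star_mem' := star_mem_ideal I

instance isClosed_idealAlgebra (I : Ideal A) [I.IsTwoSided] [hI : IsClosed (I : Set A)] :
    IsClosed (idealAlgebra I : Set A) := hI

/-- An ideal is essential if it meets every non-zero closed two-sided ideal non-trivially. -/
def IsEssential (I : Ideal A) : Prop :=
  ∀ J : Ideal A, J.IsTwoSided → IsClosed (J : Set A) → I ⊓ J = ⊥ → J = ⊥

/-- The involution of the quotient `A ⧸ I`. -/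
instance quotientStar (I : Ideal A) [I.IsTwoSided] [IsClosed (I : Set A)] : Star (A ⧸ I) where
  star := Quotient.map' star fun x y h => by
    rw [Submodule.quotientRel_def] at h ⊢
    rw [← star_sub]
    exact star_mem_ideal I h

theorem star_mk (I : Ideal A) [I.IsTwoSided] [IsClosed (I : Set A)] (x : A) :
    star (Ideal.Quotient.mk I x) = Ideal.Quotient.mk I (star x) := rfl

instance quotientStarRing (I : Ideal A) [I.IsTwoSided] [IsClosed (I : Set A)] :
    StarRing (A ⧸ I) where
  star_involutive := by
    intro x
    obtain ⟨x, rfl⟩ := Ideal.Quotient.mk_surjective x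
    rw [star_mk, star_mk, star_star]
  star_mul := by
    intro x y
    obtain ⟨x, rfl⟩ := Ideal.Quotient.mk_surjective x
    obtain ⟨y, rfl⟩ := Ideal.Quotient.mk_surjective y
    rw [← map_mul, star_mk, star_mk, star_mk, star_mul, map_mul]
  star_add := by
    intro x y
    obtain ⟨x, rfl⟩ := Ideal.Quotient.mk_surjective x
    obtain ⟨y, rfl⟩ := Ideal.Quotient.mk_surjective y
    rw [← map_add, star_mk, star_mk, star_mk, star_add, map_add]

/-- The quotient norm makes `A ⧸ I` a normed ring. -/
noncomputable instance quotientNormedRing (I : Ideal A) [I.IsTwoSided] [IsClosed (I : Set A)] :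
    NormedRing (A ⧸ I) where
  __ := Submodule.Quotient.normedAddCommGroup I
  __ := Ideal.Quotient.ring I
  norm_mul_le x y := by
    refine le_of_forall_pos_le_add fun ε hε => ?_
    have ht : Filter.Tendsto (fun t : ℝ => (‖x‖ + t) * (‖y‖ + t)) (nhdsWithin 0 (Set.Ioi 0))
        (nhds (‖x‖ * ‖y‖)) := by
      have : Continuous fun t : ℝ => (‖x‖ + t) * (‖y‖ + t) := by fun_prop
      simpa using (this.tendsto 0).mono_left nhdsWithin_le_nhds
    obtain ⟨t, ht1, ht0⟩ := ((ht.eventually (gt_mem_nhds (lt_add_of_pos_right _ hε))).and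
      self_mem_nhdsWithin).exists
    obtain ⟨a, rfl, ha⟩ := Submodule.Quotient.norm_mk_lt x ht0
    obtain ⟨b, rfl, hb⟩ := Submodule.Quotient.norm_mk_lt y ht0
    calc _ ≤ ‖a * b‖ := Submodule.Quotient.norm_mk_le I (a * b)
      _ ≤ ‖a‖ * ‖b‖ := norm_mul_le a b
      _ ≤ _ := mul_le_mul ha.le hb.le (norm_nonneg _) ((norm_nonneg _).trans ha.le)
      _ ≤ _ := ht1.le

/-- The quotient of a unital C⋆-algebra by a closed two-sided ideal is a unital C⋆-algebra. -/
noncomputable instance quotientCStarAlgebra (I : Ideal A) [I.IsTwoSided]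
    [IsClosed (I : Set A)] : CStarAlgebra (A ⧸ I) where
  __ := quotientNormedRing I
  __ := quotientStarRing I
  __ := Ideal.Quotient.algebra (I := I) ℂ
  toCompleteSpace := Submodule.Quotient.completeSpace I
  norm_smul_le c x := (Submodule.Quotient.normedSpace I ℂ).norm_smul_le c x
  star_smul c x := by
    obtain ⟨x, rfl⟩ := Ideal.Quotient.mk_surjective x
    change Ideal.Quotient.mk I (star (c • x)) = Ideal.Quotient.mk I (star c • star x)
    rw [star_smul]
  norm_mul_self_le x := by
    obtain ⟨x, rfl⟩ := Ideal.Quotient.mk_surjective x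
    refine le_of_forall_pos_le_add fun ε hε => ?_
    rw [star_mk, ← map_mul]
    obtain ⟨y, hy, hyn⟩ := Submodule.Quotient.norm_mk_lt (S := I)
      (Ideal.Quotient.mk I (star x * x)) (half_pos hε)
    have hyI : star x * x - y ∈ I := (Submodule.Quotient.eq I).1 hy.symm
    obtain ⟨e, heI, hesa, he1, hle⟩ := exists_approx I hyI (half_pos hε)
    have hstar : star (1 - e) = 1 - e := by rw [star_sub, star_one, hesa.star_eq]
    have hmk : Ideal.Quotient.mk I x = Ideal.Quotient.mk I (x * (1 - e)) := by
      refine (Ideal.Quotient.mk_eq_mk_iff_sub_mem _ _).2 ?_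
      rw [mul_sub, mul_one, sub_sub_cancel]
      exact I.mul_mem_left _ heI
    have h1 : ‖Ideal.Quotient.mk I x‖ ≤ ‖x * (1 - e)‖ := by
      rw [hmk]
      exact Submodule.Quotient.norm_mk_le I _
    have h2 : star (x * (1 - e)) * (x * (1 - e))
        = (1 - e) * y * (1 - e) + (1 - e) * ((star x * x - y) * (1 - e)) := by
      rw [star_mul, hstar]
      noncomm_ring
    have h3 : ‖(1 - e) * y * (1 - e)‖ ≤ ‖y‖ := by
      calc _ ≤ ‖1 - e‖ * ‖y‖ * ‖1 - e‖ :=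
            (norm_mul_le _ _).trans (by gcongr; exact norm_mul_le _ _)
        _ ≤ 1 * ‖y‖ * 1 := by gcongr
        _ = ‖y‖ := by ring
    have h4 : ‖(1 - e) * ((star x * x - y) * (1 - e))‖ ≤ ε / 2 := by
      calc _ ≤ ‖1 - e‖ * ‖(star x * x - y) * (1 - e)‖ := norm_mul_le _ _
        _ ≤ 1 * (ε / 2) := by gcongr
        _ = ε / 2 := one_mul _
    calc _ ≤ ‖x * (1 - e)‖ * ‖x * (1 - e)‖ :=
          mul_le_mul h1 h1 (norm_nonneg _) (norm_nonneg _)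
      _ = ‖star (x * (1 - e)) * (x * (1 - e))‖ := CStarRing.norm_star_mul_self.symm
      _ ≤ ‖y‖ + ε / 2 := by
          rw [h2]
          exact (norm_add_le _ _).trans (add_le_add h3 h4)
      _ ≤ _ := by linarith

end Ideals

end CStarTrace

/-!
A bounded trace `τ` on an ideal extends to the whole algebra: if `φ` is any bounded functional
extending `τ` and `e` runs through an approximate unit of the ideal, a limit point `ψ` of the
functionals `φ (e ·)` is a trace, because `φ (e x* x) = τ (y* y)` for some `y` in the ideal with
`y* y = x e x* ≤ x x*`, so that `0 ≤ ψ (x* x) ≤ ψ (x x*)`. If `τ` is faithful, then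
`ψ (a* a) = 0` forces `a` to annihilate the ideal. This gives (iii), and (iv) by adding a faithful
trace pulled back from the quotient.

For (i), fullness of the bimodule and invertibility of positive elements above `1` give finitely
many `xᵢ` with `∑ ⟨xᵢ, xᵢ⟩_B = 1`, and `b ↦ ∑ τ ⟨xᵢ b, xᵢ⟩_A` is a faithful trace, namely the one
with `⟨y, z⟩_B ↦ τ ⟨z, y⟩_A`.

For (ii), traces on the factors extend to bounded functionals `φ` on `B(H)` and `ψ` on `B(K)`, and
their product is the composition of `φ` with the slice map `id ⊗ ψ`. The slice `id ⊗ ψ` maps the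
minimal tensor product into the first factor. It is positive and faithful there because the vector
slices, which compress an operator to `K`, are positive and jointly faithful and map the minimal
tensor product into the second factor, where `ψ` is positive and faithful.
-/

namespace CStarTrace

open Filter Topology
open scoped ComplexOrder CStarAlgebra

/-! ### Bounded traces -/

section Basic

variable {A D : Type*} [NonUnitalCStarAlgebra A] [NonUnitalCStarAlgebra D] {τ σ : A →L[ℂ] ℂ}

theorem isBoundedTrace_iff : IsBoundedTrace τ ↔
    (∀ x, 0 ≤ τ (star x * x)) ∧ ∀ x, τ (star x * x) = τ (x * star x) :=
  ⟨fun h ↦ ⟨fun x ↦ Complex.nonneg_iff.2 ⟨h.re_nonneg x, (h.im_eq_zero x).symm⟩, h.trace⟩,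
    fun h ↦ ⟨fun x ↦ (Complex.nonneg_iff.1 (h.1 x)).1,
      fun x ↦ (Complex.nonneg_iff.1 (h.1 x)).2.symm, h.2⟩⟩

theorem IsBoundedTrace.star_mul_self_nonneg (hτ : IsBoundedTrace τ) (x : A) :
    0 ≤ τ (star x * x) :=
  (isBoundedTrace_iff.1 hτ).1 x

theorem monotone_of_star_mul_self_nonneg [PartialOrder A] [StarOrderedRing A]
    (hτ : ∀ x, 0 ≤ τ (star x * x)) : Monotone τ := fun a b hab ↦ by
  obtain ⟨x, hx⟩ := CStarAlgebra.nonneg_iff_eq_star_mul_self.1 (sub_nonneg.2 hab)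
  simpa only [hx.symm, map_sub, sub_nonneg] using hτ x

theorem IsBoundedTrace.mul_comm (hτ : IsBoundedTrace τ) (x y : A) : τ (x * y) = τ (y * x) := by
  suffices polarization : ∀ x y : A, τ (star y * x) = τ (x * star y) by
    simpa using polarization y (star x)
  intro x y
  have hx := hτ.trace x
  have hy := hτ.trace y
  have hadd := hτ.trace (x + y)
  have hI := hτ.trace (x + Complex.I • y)
  simp only [star_add, star_smul, add_mul, mul_add, smul_mul_assoc, mul_smul_comm, map_add,
    map_smul, smul_eq_mul, Complex.star_def, Complex.conj_I] at hadd hI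
  have hI' : Complex.I *
      (τ (star x * y) - τ (star y * x) + τ (x * star y) - τ (y * star x)) = 0 := by
    linear_combination hI - hx - (-Complex.I * Complex.I) * hy
  have hdiff := (mul_eq_zero.1 hI').resolve_left Complex.I_ne_zero
  linear_combination (hadd - hx - hy - hdiff) / 2

theorem IsBoundedTrace.add (hτ : IsBoundedTrace τ) (hσ : IsBoundedTrace σ) :
    IsBoundedTrace (τ + σ) :=
  isBoundedTrace_iff.2 ⟨fun x ↦ add_nonneg (hτ.star_mul_self_nonneg x) (hσ.star_mul_self_nonneg x),
    fun x ↦ congrArg₂ (· + ·) (hτ.trace x) (hσ.trace x)⟩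

theorem IsBoundedTrace.smul (hτ : IsBoundedTrace τ) {c : ℂ} (hc : 0 ≤ c) :
    IsBoundedTrace (c • τ) :=
  isBoundedTrace_iff.2 ⟨fun x ↦ mul_nonneg hc (hτ.star_mul_self_nonneg x),
    fun x ↦ congrArg (c * ·) (hτ.trace x)⟩

/-- A ⋆-homomorphism of C⋆-algebras as a bounded linear map. -/
noncomputable def starHomCLM (f : D →⋆ₙₐ[ℂ] A) : D →L[ℂ] A :=
  ⟨(f : D →ₗ[ℂ] A), map_continuous f⟩

@[simp]
theorem starHomCLM_apply (f : D →⋆ₙₐ[ℂ] A) (x : D) : starHomCLM f x = f x := rfl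

theorem IsBoundedTrace.comp (hτ : IsBoundedTrace τ) (f : D →⋆ₙₐ[ℂ] A) :
    IsBoundedTrace (τ ∘L starHomCLM f) :=
  isBoundedTrace_iff.2
    ⟨fun x ↦ by simpa [map_star] using hτ.star_mul_self_nonneg (f x),
      fun x ↦ by simpa [map_star] using hτ.trace (f x)⟩

theorem HasFaithfulBoundedTrace.comap (h : HasFaithfulBoundedTrace A) {f : D →⋆ₙₐ[ℂ] A}
    (hf : Function.Injective f) : HasFaithfulBoundedTrace D := by
  obtain ⟨τ, hτ, hτf⟩ := h
  refine ⟨_, hτ.comp f, fun x hx ↦ (map_eq_zero_iff f hf).1 (hτf _ ?_)⟩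
  simpa [map_star] using hx

theorem IsFaithful.ne_zero [Nontrivial A] (hτ : IsFaithful τ) : τ ≠ 0 := by
  rintro rfl
  obtain ⟨x, hx⟩ := exists_ne (0 : A)
  exact hx (hτ x rfl)

theorem hasFaithfulTrace_iff :
    HasFaithfulTrace A ↔ Nontrivial A ∧ HasFaithfulBoundedTrace A := by
  constructor
  · rintro ⟨τ, hτ, hτf⟩
    refine ⟨not_subsingleton_iff_nontrivial.1 fun _ ↦ ?_, τ, hτ.toIsBoundedTrace, hτf⟩
    have hnorm := hτ.norm_eq_one
    rw [Subsingleton.elim τ 0, norm_zero] at hnorm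
    exact zero_ne_one hnorm
  · rintro ⟨_, τ, hτ, hτf⟩
    have hnorm : (‖τ‖ : ℂ) ≠ 0 := Complex.ofReal_ne_zero.2 (norm_ne_zero_iff.2 hτf.ne_zero)
    refine ⟨(‖τ‖ : ℂ)⁻¹ • τ, ⟨hτ.smul (inv_nonneg.2 (mod_cast norm_nonneg τ)), ?_⟩, fun x hx ↦
      hτf x ((smul_eq_zero.1 hx).resolve_left (inv_ne_zero hnorm))⟩
    rw [norm_smul, norm_inv, Complex.norm_real, norm_norm, inv_mul_cancel₀ (mod_cast hnorm)]

/-- By traciality `τ ((xy)* (xy)) = τ (x (y y*) x*)`, which is at most a multiple of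
`τ (x x*) = τ (x* x)`. -/
theorem IsBoundedTrace.star_mul_self_mul_eq_zero (hτ : IsBoundedTrace τ) {x : A}
    (hx : τ (star x * x) = 0) (y : A) : τ (star (x * y) * (x * y)) = 0 := by
  let _ := CStarAlgebra.spectralOrder A
  have := CStarAlgebra.spectralOrderedRing A
  refine le_antisymm ?_ (hτ.star_mul_self_nonneg _)
  calc τ (star (x * y) * (x * y)) = τ (x * (y * star y) * star x) := by
        rw [hτ.trace, star_mul]; simp only [mul_assoc]
    _ ≤ τ (‖y * star y‖ • (x * star x)) :=
        monotone_of_star_mul_self_nonneg hτ.star_mul_self_nonneg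
          (CStarAlgebra.star_right_conjugate_le_norm_smul (.mul_star_self y))
    _ = 0 := by rw [τ.map_smul_of_tower, ← hτ.trace, hx, smul_zero]

/-- Positive linear functionals on a C⋆-algebra are automatically bounded. -/
theorem hasFaithfulBoundedTrace_of_linearMap (ω : A →ₗ[ℂ] ℂ) (hpos : ∀ x, 0 ≤ ω (star x * x))
    (htrace : ∀ x, ω (star x * x) = ω (x * star x)) (hfaith : ∀ x, ω (star x * x) = 0 → x = 0) :
    HasFaithfulBoundedTrace A := by
  let _ := CStarAlgebra.spectralOrder A
  have := CStarAlgebra.spectralOrderedRing A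
  obtain ⟨C, hC⟩ := (PositiveLinearMap.mk₀ ω fun a ha ↦ by
    obtain ⟨x, rfl⟩ := CStarAlgebra.nonneg_iff_eq_star_mul_self.1 ha
    exact hpos x).exists_norm_apply_le
  exact ⟨ω.mkContinuous C hC, isBoundedTrace_iff.2 ⟨hpos, htrace⟩, hfaith⟩

end Basic

/-! ### Extending traces from ideals -/

section Extension

theorem exists_tendsto_apply_of_norm_le {α E : Type*} [NormedAddCommGroup E] [NormedSpace ℂ E]
    {f : α → E →L[ℂ] ℂ} {C : ℝ} {l : Ultrafilter α} (hf : ∀ᶠ i in l, ‖f i‖ ≤ C) :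
    ∃ g : E →L[ℂ] ℂ, ∀ x, Tendsto (fun i ↦ f i x) l (𝓝 (g x)) := by
  obtain ⟨g, -, hg⟩ := (WeakDual.isCompact_closedBall (𝕜 := ℂ) (E := E) 0 C).ultrafilter_le_nhds
    (l.map fun i ↦ StrongDual.toWeakDual (f i)) (tendsto_principal.2 <| by simpa using hf)
  exact ⟨WeakDual.toStrongDual g, fun x ↦ ((WeakDual.eval_continuous x).tendsto g).comp hg⟩

variable {A J D : Type*} [NonUnitalCStarAlgebra A] [NonUnitalCStarAlgebra J]
  [NonUnitalCStarAlgebra D]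

theorem exists_extension_of_injective {f : D →⋆ₙₐ[ℂ] A} (hf : Function.Injective f)
    (φ : D →L[ℂ] ℂ) : ∃ ψ : A →L[ℂ] ℂ, ∀ x, ψ (f x) = φ x := by
  let ι : D →ₗᵢ[ℂ] A := ⟨(f : D →ₗ[ℂ] A), NonUnitalStarAlgHom.norm_map f hf⟩
  obtain ⟨ψ, hψ, -⟩ := exists_extension_norm_eq (LinearMap.range ι.toLinearMap)
    (φ ∘L (ι.equivRange.symm.toContinuousLinearEquiv : _ →L[ℂ] D))
  exact ⟨ψ, fun x ↦ show ψ (ι x) = φ x by simpa using hψ (ι.equivRange x)⟩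

/-- An embedding of C⋆-algebras whose range is a (closed, hence two-sided) ideal. -/
structure IsIdealEmbedding (ι : J →⋆ₙₐ[ℂ] A) : Prop where
  injective : Function.Injective ι
  exists_mul_left : ∀ a j, ∃ k, ι k = a * ι j

namespace IsIdealEmbedding

variable {ι : J →⋆ₙₐ[ℂ] A} {τ : J →L[ℂ] ℂ}

theorem exists_mul_right (hι : IsIdealEmbedding ι) (j : J) (a : A) : ∃ k, ι k = ι j * a := by
  obtain ⟨k, hk⟩ := hι.exists_mul_left (star a) (star j)
  exact ⟨star k, by rw [map_star, hk, star_mul, star_star, map_star, star_star]⟩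

theorem exists_limit_along_approximateUnit [PartialOrder J] [StarOrderedRing J]
    (hι : IsIdealEmbedding ι) (φ : A →L[ℂ] ℂ) : ∃ (l : Ultrafilter J) (ψ : A →L[ℂ] ℂ),
      (l : Filter J) ≤ CStarAlgebra.approximateUnit J ∧
        ∀ x, Tendsto (fun e ↦ φ (ι e * x)) l (𝓝 (ψ x)) := by
  have hl := CStarAlgebra.increasingApproximateUnit J
  have hle := Ultrafilter.of_le (CStarAlgebra.approximateUnit J)
  have hbound : ∀ᶠ e in Ultrafilter.of (CStarAlgebra.approximateUnit J),
      ‖φ ∘L ContinuousLinearMap.mul ℂ A (ι e)‖ ≤ ‖φ‖ := by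
    filter_upwards [hle hl.eventually_norm] with e he
    calc ‖φ ∘L ContinuousLinearMap.mul ℂ A (ι e)‖
        ≤ ‖φ‖ * ‖ContinuousLinearMap.mul ℂ A (ι e)‖ := ContinuousLinearMap.opNorm_comp_le _ _
      _ ≤ ‖φ‖ * 1 := by
        gcongr
        exact (ContinuousLinearMap.opNorm_mul_apply_le ℂ A _).trans
          ((NonUnitalStarAlgHom.norm_map ι hι.injective e).trans_le he)
      _ = ‖φ‖ := mul_one _
  obtain ⟨ψ, hψ⟩ := exists_tendsto_apply_of_norm_le hbound
  exact ⟨_, ψ, hle, hψ⟩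

theorem apply_star_mul_self_mul (hι : IsIdealEmbedding ι) (hτ : IsBoundedTrace τ)
    {φ : A →L[ℂ] ℂ} (hφ : ∀ j, φ (ι j) = τ j) {s y : J} {x : A} (hy : ι y = ι s * star x) :
    φ (ι (star s * s) * (star x * x)) = τ (y * star y) := by
  obtain ⟨w, hw⟩ := hι.exists_mul_right y x
  calc φ (ι (star s * s) * (star x * x)) = φ (ι (star s * w)) := by
        simp only [map_mul, hw, hy, mul_assoc]
    _ = φ (ι (w * star s)) := by rw [hφ, hφ, hτ.mul_comm]
    _ = φ (ι (y * star y)) := by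
        simp only [map_mul, map_star, hw, hy, star_mul, star_star, mul_assoc]
    _ = τ (y * star y) := hφ _

theorem exists_extension (hι : IsIdealEmbedding ι) (hτ : IsBoundedTrace τ) :
    ∃ ψ : A →L[ℂ] ℂ, IsBoundedTrace ψ ∧ ∀ j, ψ (ι j) = τ j := by
  let _ := CStarAlgebra.spectralOrder A
  have := CStarAlgebra.spectralOrderedRing A
  let _ := CStarAlgebra.spectralOrder J
  have := CStarAlgebra.spectralOrderedRing J
  obtain ⟨φ, hφ⟩ := exists_extension_of_injective hι.injective τ
  obtain ⟨l, ψ, hl, hψ⟩ := hι.exists_limit_along_approximateUnit φ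
  have hunit := CStarAlgebra.increasingApproximateUnit J
  have hext : ∀ j, ψ (ι j) = τ j := fun j ↦ tendsto_nhds_unique (hψ (ι j)) <| by
    simpa only [← map_mul, hφ, Function.comp_def] using (τ.continuous.tendsto j).comp
      ((hunit.tendsto_mul_right j).mono_left hl)
  have hfactor : ∀ᶠ e in l, ∀ x : A, ∃ y, φ (ι e * (star x * x)) = τ (star y * y) ∧
      ι (star y * y) = x * ι e * star x := by
    filter_upwards [hl hunit.eventually_nonneg] with e he x
    obtain ⟨s, rfl⟩ := CStarAlgebra.nonneg_iff_eq_star_mul_self.1 he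
    obtain ⟨y, hy⟩ := hι.exists_mul_right s (star x)
    refine ⟨y, (hι.apply_star_mul_self_mul hτ hφ hy).trans (hτ.trace y).symm, ?_⟩
    simp only [map_mul, map_star, hy, star_mul, star_star, mul_assoc]
  have hpos : ∀ x, 0 ≤ ψ (star x * x) := fun x ↦ ge_of_tendsto (hψ _) <| by
    filter_upwards [hfactor] with e he
    obtain ⟨y, hy, -⟩ := he x
    exact hy ▸ hτ.star_mul_self_nonneg y
  have hle : ∀ x, ψ (star x * x) ≤ ψ (x * star x) := fun x ↦ le_of_tendsto (hψ _) <| by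
    filter_upwards [hfactor, hl hunit.eventually_isSelfAdjoint, hl hunit.eventually_norm]
      with e he hsa hnorm
    obtain ⟨y, hy, hyx⟩ := he x
    rw [hy, ← hext, hyx]
    refine monotone_of_star_mul_self_nonneg hpos ?_
    calc x * ι e * star x ≤ ‖ι e‖ • (x * star x) :=
          CStarAlgebra.star_right_conjugate_le_norm_smul (hsa.map ι)
      _ ≤ x * star x := smul_le_of_le_one_left (mul_star_self_nonneg x)
          ((NonUnitalStarAlgHom.norm_apply_le ι e).trans hnorm)
  exact ⟨ψ, isBoundedTrace_iff.2
    ⟨hpos, fun x ↦ (hle x).antisymm (by simpa using hle (star x))⟩, hext⟩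

theorem hasFaithfulBoundedTrace (hι : IsIdealEmbedding ι)
    (hann : ∀ a, (∀ j, a * ι j = 0) → a = 0) (hJ : HasFaithfulBoundedTrace J) :
    HasFaithfulBoundedTrace A := by
  obtain ⟨τ, hτ, hτf⟩ := hJ
  obtain ⟨ψ, hψ, hext⟩ := hι.exists_extension hτ
  refine ⟨ψ, hψ, fun a ha ↦ hann a fun j ↦ ?_⟩
  obtain ⟨k, hk⟩ := hι.exists_mul_left a j
  rw [← hk, hτf k, map_zero]
  rw [← hext, map_mul, map_star, hk, hψ.star_mul_self_mul_eq_zero ha]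

theorem hasFaithfulBoundedTrace_of_quotient (hι : IsIdealEmbedding ι) {q : A →⋆ₙₐ[ℂ] D}
    (hq : ∀ a, q a = 0 → a ∈ Set.range ι) (hJ : HasFaithfulBoundedTrace J)
    (hD : HasFaithfulBoundedTrace D) : HasFaithfulBoundedTrace A := by
  obtain ⟨τ, hτ, hτf⟩ := hJ
  obtain ⟨σ, hσ, hσf⟩ := hD
  obtain ⟨ψ, hψ, hext⟩ := hι.exists_extension hτ
  refine ⟨ψ + σ ∘L starHomCLM q, hψ.add (hσ.comp q), fun x hx ↦ ?_⟩
  obtain ⟨hψx, hσx⟩ := (add_eq_zero_iff_of_nonneg (hψ.star_mul_self_nonneg x)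
    ((hσ.comp q).star_mul_self_nonneg x)).1 hx
  obtain ⟨j, rfl⟩ := hq x (hσf _ (by simpa [map_star] using hσx))
  rw [hτf j (by simpa [← hext, map_star] using hψx), map_zero]

end IsIdealEmbedding

end Extension

/-! ### Ideals, quotients and multiplier algebras -/

section Ideals

variable {A : Type*} [CStarAlgebra A] (I : Ideal A)

/-- The ideal of all `a` with `a I = 0`. -/
def leftAnnihilator : Ideal A where
  carrier := {a | ∀ j ∈ I, a * j = 0}
  add_mem' ha hb j hj := by rw [add_mul, ha j hj, hb j hj, add_zero]
  zero_mem' j _ := zero_mul j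
  smul_mem' c a ha j hj := by rw [smul_eq_mul, mul_assoc, ha j hj, mul_zero]

theorem isTwoSided_leftAnnihilator : (leftAnnihilator I).IsTwoSided :=
  ⟨fun b ha j hj ↦ (mul_assoc _ b j).trans (ha _ (I.mul_mem_left b hj))⟩

theorem isClosed_leftAnnihilator : IsClosed (leftAnnihilator I : Set A) := by
  have hset : (leftAnnihilator I : Set A) = ⋂ j ∈ I, {a | a * j = 0} := by
    ext a
    simp [leftAnnihilator]
  rw [hset]
  exact isClosed_biInter fun j _ ↦ isClosed_eq (by fun_prop) continuous_const

variable [I.IsTwoSided] [IsClosed (I : Set A)]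

theorem inf_leftAnnihilator_eq_bot : I ⊓ leftAnnihilator I = ⊥ :=
  (Submodule.eq_bot_iff _).2 fun x hx ↦
    (CStarRing.mul_star_self_eq_zero_iff x).1 (hx.2 _ (star_mem_ideal I hx.1))

variable {I} in
theorem IsEssential.eq_zero_of_mul_eq_zero (h : IsEssential I) {a : A}
    (ha : ∀ j ∈ I, a * j = 0) : a = 0 :=
  (Submodule.eq_bot_iff _).1 (h _ (isTwoSided_leftAnnihilator I) (isClosed_leftAnnihilator I)
    (inf_leftAnnihilator_eq_bot I)) a ha

theorem isIdealEmbedding_subtype :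
    IsIdealEmbedding (NonUnitalStarSubalgebraClass.subtype (idealAlgebra I)) where
  injective := Subtype.val_injective
  exists_mul_left a j := ⟨⟨a * j, I.mul_mem_left a j.2⟩, rfl⟩

variable {I} in
theorem IsEssential.hasFaithfulTrace [Nontrivial A] (h : IsEssential I)
    (hI : HasFaithfulBoundedTrace (idealAlgebra I)) : HasFaithfulTrace A :=
  hasFaithfulTrace_iff.2 ⟨‹_›, (isIdealEmbedding_subtype I).hasFaithfulBoundedTrace
    (fun _ ha ↦ h.eq_zero_of_mul_eq_zero fun j hj ↦ ha ⟨j, hj⟩) hI⟩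

/-- The quotient map as a ⋆-homomorphism. -/
def quotientStarHom : A →⋆ₙₐ[ℂ] A ⧸ I :=
  { Ideal.Quotient.mk I with
    map_smul' := fun _ _ ↦ rfl
    map_star' := fun _ ↦ rfl }

theorem quotientStarHom_eq_zero_iff {a : A} : quotientStarHom I a = 0 ↔ a ∈ I :=
  Ideal.Quotient.eq_zero_iff_mem

variable {I} in
theorem hasFaithfulTrace_of_quotient (hI : HasFaithfulTrace (idealAlgebra I))
    (hQ : HasFaithfulTrace (A ⧸ I)) : HasFaithfulTrace A := by
  obtain ⟨_, hQ⟩ := hasFaithfulTrace_iff.1 hQ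
  refine hasFaithfulTrace_iff.2 ⟨(Ideal.Quotient.mk_surjective (I := I)).nontrivial,
    (isIdealEmbedding_subtype I).hasFaithfulBoundedTrace_of_quotient (q := quotientStarHom I)
      (fun a ha ↦ ⟨⟨a, (quotientStarHom_eq_zero_iff I).1 ha⟩, rfl⟩)
      (hasFaithfulTrace_iff.1 hI).2 hQ⟩

end Ideals

section Multiplier

variable {J : Type*} [NonUnitalCStarAlgebra J]

theorem multiplier_mul_coe (a : 𝓜(ℂ, J)) (j : J) : a * j = (a.fst j : J) := by
  have hsnd : (a * j - (a.fst j : J)).snd = 0 := by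
    ext x
    simpa using sub_eq_zero.2 (a.central x j)
  rw [← sub_eq_zero, ← norm_eq_zero, ← DoubleCentralizer.norm_snd, hsnd, norm_zero]

theorem isIdealEmbedding_coeHom :
    IsIdealEmbedding (DoubleCentralizer.coeHom (𝕜 := ℂ) (A := J)) where
  injective := .of_comp (f := fun a : 𝓜(ℂ, J) ↦ a.fst) <|
    (ContinuousLinearMap.isometry_mul ℂ J).injective
  exists_mul_left a j := ⟨a.fst j, (multiplier_mul_coe a j).symm⟩

theorem multiplier_eq_zero_of_mul_coe_eq_zero {a : 𝓜(ℂ, J)} (ha : ∀ j : J, a * j = 0) :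
    a = 0 := by
  have hfst : a.fst = 0 := by
    ext j
    refine (map_eq_zero_iff _ isIdealEmbedding_coeHom.injective).1 ?_
    exact (multiplier_mul_coe a j).symm.trans (ha j)
  rw [← norm_eq_zero, ← DoubleCentralizer.norm_fst, hfst, norm_zero]

theorem nontrivial_multiplier_iff : Nontrivial 𝓜(ℂ, J) ↔ Nontrivial J := by
  refine ⟨fun _ ↦ not_subsingleton_iff_nontrivial.1 fun _ ↦ ?_, fun _ ↦
    isIdealEmbedding_coeHom.injective.nontrivial⟩
  refine one_ne_zero (α := 𝓜(ℂ, J)) (multiplier_eq_zero_of_mul_coe_eq_zero fun j ↦ ?_)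
  rw [Subsingleton.elim j 0, one_mul]
  exact map_zero DoubleCentralizer.coeHom

theorem hasFaithfulTrace_multiplier_iff : HasFaithfulTrace J ↔ HasFaithfulTrace 𝓜(ℂ, J) := by
  rw [hasFaithfulTrace_iff, hasFaithfulTrace_iff, nontrivial_multiplier_iff]
  refine and_congr_right fun _ ↦ ⟨isIdealEmbedding_coeHom.hasFaithfulBoundedTrace
    fun _ ↦ multiplier_eq_zero_of_mul_coe_eq_zero,
    fun h ↦ h.comap isIdealEmbedding_coeHom.injective⟩

end Multiplier

/-! ### Morita equivalence -/

theorem exists_star_mul_mul_eq_one {B : Type*} [CStarAlgebra B] [PartialOrder B]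
    [StarOrderedRing B] {c : B} (h0 : 0 ≤ c) (hc : IsUnit c) : ∃ d, star d * c * d = 1 := by
  refine ⟨c ^ (-(1 / 2) : ℝ), ?_⟩
  rw [(IsSelfAdjoint.of_nonneg CFC.rpow_nonneg).star_eq]
  nth_rewrite 2 [← CFC.rpow_one c h0]
  rw [← CFC.rpow_add hc, ← CFC.rpow_add hc]
  norm_num
  exact CFC.rpow_zero c h0

namespace ImprimitivityBimodule

open scoped RightActions

variable {A B X : Type*} [CStarAlgebra A] [CStarAlgebra B]
    [NormedAddCommGroup X] [NormedSpace ℂ X] [CompleteSpace X] [Module A X] [Module Bᵐᵒᵖ X]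
    [IsScalarTower ℂ A X] [IsScalarTower ℂ Bᵐᵒᵖ X] [SMulCommClass A Bᵐᵒᵖ X]
    (E : ImprimitivityBimodule A B X)

theorem inB_add_left (x y z : X) : E.inB (x + y) z = E.inB x z + E.inB y z := by
  rw [← E.star_inB, E.inB_add_right, star_add, E.star_inB, E.star_inB]

theorem inB_smul_left (b : B) (x y : X) : E.inB (x <• b) y = star b * E.inB x y := by
  rw [← E.star_inB, E.inB_smul_right, star_mul, E.star_inB]

theorem inA_complex_smul (c : ℂ) (x y : X) : E.inA (c • x) y = c • E.inA x y := by
  rw [← one_smul A x, ← smul_assoc, E.inA_smul_left, one_smul, smul_mul_assoc, one_mul]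

theorem inB_complex_smul (c : ℂ) (x y : X) : E.inB x (c • y) = c • E.inB x y := by
  rw [← one_smul Bᵐᵒᵖ y, ← smul_assoc, ← MulOpposite.op_one, ← MulOpposite.op_smul,
    E.inB_smul_right, MulOpposite.op_one, one_smul, mul_smul_comm, mul_one]

theorem inA_self_eq_zero_iff {x : X} : E.inA x x = 0 ↔ x = 0 := by
  rw [← norm_eq_zero, ← E.norm_sq_eq_inA, sq_eq_zero_iff, norm_eq_zero]

theorem inB_self_eq_zero_iff {x : X} : E.inB x x = 0 ↔ x = 0 := by
  rw [← norm_eq_zero, ← E.norm_sq_eq_inB, sq_eq_zero_iff, norm_eq_zero]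

include E in
theorem nontrivial_right [Nontrivial A] : Nontrivial B := by
  refine not_subsingleton_iff_nontrivial.1 fun _ ↦ one_ne_zero (α := A) ?_
  have hX : ∀ x : X, x = 0 := fun x ↦ E.inB_self_eq_zero_iff.1 (Subsingleton.elim _ _)
  have hspan : Submodule.span ℂ {a : A | ∃ x y, a = E.inA x y} = ⊥ := by
    refine Submodule.span_eq_bot.2 ?_
    rintro _ ⟨x, y, rfl⟩
    rw [hX x, hX y, E.inA_self_eq_zero_iff]
  simpa [hspan] using E.full_inA 1

theorem exists_sum_inB_eq_one : ∃ (n : ℕ) (u w : Fin n → X), ∑ i, E.inB (u i) (w i) = 1 := by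
  obtain ⟨r, hr, hr1⟩ := Metric.mem_closure_iff.1 (E.full_inB (1 : B)) 1 one_pos
  have hunit : IsUnit r := by
    rw [dist_eq_norm] at hr1
    simpa using isUnit_one_sub_of_norm_lt_one hr1
  obtain ⟨s, hs⟩ := hunit.exists_right_inv
  obtain ⟨n, f, g, hg⟩ := Submodule.mem_span_set'.1 hr
  choose u v huv using fun i ↦ (g i).2
  refine ⟨n, u, fun i ↦ (f i • v i) <• s, ?_⟩
  simp only [E.inB_smul_right, E.inB_complex_smul, ← huv, ← Finset.sum_mul, hg, hs]

variable {ι : Type*} [Fintype ι]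

theorem sum_inB_smul_self (x : ι → X) (b : B) :
    ∑ i, E.inB (x i <• b) (x i <• b) = star b * (∑ i, E.inB (x i) (x i)) * b := by
  simp only [E.inB_smul_left, E.inB_smul_right, Finset.mul_sum, Finset.sum_mul, mul_assoc]

theorem one_le_sum_inB_add_self [PartialOrder B] [StarOrderedRing B] {u w : ι → X}
    (h : ∑ i, E.inB (u i) (w i) = 1) : 1 ≤ ∑ i, E.inB (u i + w i) (u i + w i) := by
  have hnonneg : ∀ x, 0 ≤ E.inB x x := fun x ↦
    CStarAlgebra.nonneg_iff_eq_star_mul_self.2 (E.inB_self_nonneg x)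
  have hstar : ∑ i, E.inB (w i) (u i) = 1 := by
    simp only [← E.star_inB (u _) (w _), ← star_sum, h, star_one]
  calc (1 : B) ≤ 1 + (∑ i, E.inB (u i) (u i) + 1 + ∑ i, E.inB (w i) (w i)) :=
        le_add_of_nonneg_right <| add_nonneg (add_nonneg
          (Finset.sum_nonneg fun i _ ↦ hnonneg _) zero_le_one)
          (Finset.sum_nonneg fun i _ ↦ hnonneg _)
    _ = ∑ i, E.inB (w i) (u i) + (∑ i, E.inB (u i) (u i) + ∑ i, E.inB (u i) (w i) +
          ∑ i, E.inB (w i) (w i)) := by rw [h, hstar]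
    _ = ∑ i, E.inB (u i + w i) (u i + w i) := by
        simp only [E.inB_add_left, E.inB_add_right, Finset.sum_add_distrib]
        abel

theorem exists_sum_inB_self_eq_one : ∃ (n : ℕ) (x : Fin n → X), ∑ i, E.inB (x i) (x i) = 1 := by
  let _ := CStarAlgebra.spectralOrder B
  have := CStarAlgebra.spectralOrderedRing B
  nontriviality B
  obtain ⟨n, u, w, huw⟩ := E.exists_sum_inB_eq_one
  have hle := E.one_le_sum_inB_add_self huw
  obtain ⟨d, hd⟩ := exists_star_mul_mul_eq_one (zero_le_one.trans hle)
    (CStarAlgebra.isUnit_of_le 1 hle)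
  exact ⟨n, fun i ↦ (u i + w i) <• d, (E.sum_inB_smul_self _ d).trans hd⟩

/-- The functional on `B` induced from a functional `τ` on `A` by vectors `xᵢ` of the bimodule. When
`∑ ⟨xᵢ, xᵢ⟩_B = 1` and `τ` is tracial, it does not depend on the `xᵢ`. -/
noncomputable def inducedFunctional (τ : A →L[ℂ] ℂ) (x : ι → X) : B →ₗ[ℂ] ℂ where
  toFun b := ∑ i, τ (E.inA (x i <• b) (x i))
  map_add' b c := by
    simp only [MulOpposite.op_add, add_smul, E.inA_add_left, map_add, Finset.sum_add_distrib]
  map_smul' c b := by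
    simp only [MulOpposite.op_smul, smul_assoc, E.inA_complex_smul, map_smul, Finset.smul_sum,
      RingHom.id_apply]

theorem inducedFunctional_star_mul_self (τ : A →L[ℂ] ℂ) (x : ι → X) (b : B) :
    E.inducedFunctional τ x (star b * b) = ∑ i, τ (E.inA (x i <• star b) (x i <• star b)) := by
  change ∑ i, τ (E.inA (x i <• (star b * b)) (x i)) = _
  simp only [MulOpposite.op_mul, mul_smul, E.inA_adjoint]

variable {τ : A →L[ℂ] ℂ} {x : ι → X}

theorem inducedFunctional_inB (hτ : IsBoundedTrace τ) (hx : ∑ i, E.inB (x i) (x i) = 1)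
    (y z : X) : E.inducedFunctional τ x (E.inB y z) = τ (E.inA z y) := by
  let φ : X →+ ℂ := .mk' (fun w ↦ τ (E.inA w y)) fun v w ↦ by rw [E.inA_add_left, map_add]
  have hterm : ∀ i, τ (E.inA (x i <• E.inB y z) (x i)) = φ (z <• E.inB (x i) (x i)) := fun i ↦ by
    change _ = τ (E.inA (z <• E.inB (x i) (x i)) y)
    rw [← E.inA_smul_eq_smul_inB, ← E.inA_smul_eq_smul_inB, E.inA_smul_left, E.inA_smul_left,
      hτ.mul_comm]
  calc E.inducedFunctional τ x (E.inB y z) = ∑ i, φ (z <• E.inB (x i) (x i)) :=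
        Finset.sum_congr rfl fun i _ ↦ hterm i
    _ = φ (z <• ∑ i, E.inB (x i) (x i)) := by
        rw [← map_sum, ← Finset.sum_smul]
        exact congrArg (fun c ↦ φ (c • z)) (map_sum (MulOpposite.opAddEquiv (α := B)) _ _).symm
    _ = τ (E.inA z y) := by rw [hx, MulOpposite.op_one, one_smul]; rfl

theorem inducedFunctional_trace (hτ : IsBoundedTrace τ) (hx : ∑ i, E.inB (x i) (x i) = 1)
    (b : B) : E.inducedFunctional τ x (star b * b) = E.inducedFunctional τ x (b * star b) := by
  calc E.inducedFunctional τ x (star b * b)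
      = E.inducedFunctional τ x (∑ i, E.inB (x i <• b) (x i <• b)) := by
        rw [E.sum_inB_smul_self, hx, mul_one]
    _ = ∑ i, τ (E.inA (x i <• b) (x i <• b)) := by
        simp only [map_sum, E.inducedFunctional_inB hτ hx]
    _ = E.inducedFunctional τ x (b * star b) := by
        simpa only [star_star] using (E.inducedFunctional_star_mul_self τ x (star b)).symm

theorem apply_inA_self_nonneg (hτ : IsBoundedTrace τ) (y : X) : 0 ≤ τ (E.inA y y) := by
  obtain ⟨a, ha⟩ := E.inA_self_nonneg y
  exact ha ▸ hτ.star_mul_self_nonneg a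

theorem eq_zero_of_apply_inA_self_eq_zero (hτ : IsFaithful τ) {y : X}
    (hy : τ (E.inA y y) = 0) : y = 0 := by
  obtain ⟨a, ha⟩ := E.inA_self_nonneg y
  rw [← E.inA_self_eq_zero_iff, ha, hτ a (ha ▸ hy), mul_zero]

theorem eq_zero_of_inducedFunctional_eq_zero (hτ : IsBoundedTrace τ) (hτf : IsFaithful τ)
    (hx : ∑ i, E.inB (x i) (x i) = 1) {b : B} (hb : E.inducedFunctional τ x (star b * b) = 0) :
    b = 0 := by
  rw [inducedFunctional_star_mul_self,
    Finset.sum_eq_zero_iff_of_nonneg fun i _ ↦ E.apply_inA_self_nonneg hτ _] at hb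
  have hvanish : ∀ i, x i <• star b = 0 := fun i ↦
    E.eq_zero_of_apply_inA_self_eq_zero hτf (hb i (Finset.mem_univ i))
  have hsum := E.sum_inB_smul_self x (star b)
  simp only [hvanish, E.inB_self_eq_zero_iff.2, Finset.sum_const_zero, hx, star_star,
    mul_one] at hsum
  exact (CStarRing.mul_star_self_eq_zero_iff b).1 hsum.symm

include E in
theorem hasFaithfulTrace (h : HasFaithfulTrace A) : HasFaithfulTrace B := by
  obtain ⟨_, τ, hτ, hτf⟩ := hasFaithfulTrace_iff.1 h
  obtain ⟨n, x, hx⟩ := E.exists_sum_inB_self_eq_one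
  refine hasFaithfulTrace_iff.2 ⟨E.nontrivial_right, hasFaithfulBoundedTrace_of_linearMap
    (E.inducedFunctional τ x) (fun b ↦ ?_) (E.inducedFunctional_trace hτ hx)
    fun b ↦ E.eq_zero_of_inducedFunctional_eq_zero hτ hτf hx⟩
  rw [inducedFunctional_star_mul_self]
  exact Finset.sum_nonneg fun i _ ↦ E.apply_inA_self_nonneg hτ _

end ImprimitivityBimodule

theorem MoritaEquivalent.hasFaithfulTrace {A B : Type*} [CStarAlgebra A] [CStarAlgebra B]
    (hAB : MoritaEquivalent A B) (hA : HasFaithfulTrace A) : HasFaithfulTrace B := by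
  obtain ⟨X, _, _, _, _, _, _, _, _, ⟨E⟩⟩ := hAB
  exact E.hasFaithfulTrace hA

/-! ### Slice maps -/

section HilbertTensor

variable {H K : Type*} [NormedAddCommGroup H] [InnerProductSpace ℂ H]
  [NormedAddCommGroup K] [InnerProductSpace ℂ K]

theorem HilbertTensor.inner_tmul (x x' : H) (y y' : K) :
    inner ℂ (tmul x y) (tmul x' y') = inner ℂ x x' * inner ℂ y y' :=
  (UniformSpace.Completion.inner_coe _ _).trans (TensorProduct.inner_tmul ..)

theorem HilbertTensor.clm_ext {F : Type*} [AddCommMonoid F] [Module ℂ F] [TopologicalSpace F]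
    [T2Space F] {S T : HilbertTensor H K →L[ℂ] F} (h : ∀ x y, S (tmul x y) = T (tmul x y)) :
    S = T := by
  ext z
  refine UniformSpace.Completion.induction_on (α := H ⊗[ℂ] K) z
    (isClosed_eq S.continuous T.continuous) fun w ↦ ?_
  induction w using TensorProduct.induction_on with
  | zero => exact (map_zero S).trans (map_zero T).symm
  | tmul x y => exact h x y
  | add v w hv hw =>
    rw [UniformSpace.Completion.coe_add]
    exact (map_add S _ _).trans ((congrArg₂ _ hv hw).trans (map_add T _ _).symm)

theorem HilbertTensor.ext_inner_tmul {u v : HilbertTensor H K}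
    (h : ∀ x y, inner ℂ u (tmul x y) = inner ℂ v (tmul x y)) : u = v :=
  (innerSL_inj (𝕜 := ℂ)).1 (HilbertTensor.clm_ext h)

/-- The operators `y ↦ x ⊗ y`, as a bounded linear function of `x`. -/
noncomputable def tensorLeft (H K : Type*) [NormedAddCommGroup H] [InnerProductSpace ℂ H]
    [NormedAddCommGroup K] [InnerProductSpace ℂ K] : H →L[ℂ] K →L[ℂ] HilbertTensor H K :=
  ContinuousLinearMap.compL ℂ K (H ⊗[ℂ] K) (HilbertTensor H K)
    (UniformSpace.Completion.toComplL (𝕜 := ℂ) (E := H ⊗[ℂ] K)) ∘L TensorProduct.mkL ℂ H K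

theorem tensorLeft_apply (x : H) (y : K) : tensorLeft H K x y = HilbertTensor.tmul x y := rfl

theorem HilbertTensor.add_tmul (x x' : H) (y : K) : tmul (x + x') y = tmul x y + tmul x' y :=
  congrArg (· y) (map_add (tensorLeft H K) x x')

theorem HilbertTensor.tmul_add (x : H) (y y' : K) : tmul x (y + y') = tmul x y + tmul x y' :=
  map_add (tensorLeft H K x) y y'

theorem HilbertTensor.smul_tmul (c : ℂ) (x : H) (y : K) : tmul (c • x) y = c • tmul x y :=
  congrArg (· y) (map_smul (tensorLeft H K) c x)

theorem HilbertTensor.tmul_smul (c : ℂ) (x : H) (y : K) : tmul x (c • y) = c • tmul x y :=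
  map_smul (tensorLeft H K x) c y

theorem HilbertTensor.nontrivial_left [Nontrivial (HilbertTensor H K)] : Nontrivial H := by
  by_contra! hH
  refine one_ne_zero (α := HilbertTensor H K →L[ℂ] HilbertTensor H K) (clm_ext fun x y ↦ ?_)
  rw [← tensorLeft_apply, Subsingleton.elim x 0, map_zero, zero_apply, map_zero, map_zero]

theorem HilbertTensor.nontrivial_right [Nontrivial (HilbertTensor H K)] : Nontrivial K := by
  by_contra! hK
  refine one_ne_zero (α := HilbertTensor H K →L[ℂ] HilbertTensor H K) (clm_ext fun x y ↦ ?_)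
  rw [← tensorLeft_apply, Subsingleton.elim y 0, map_zero, map_zero, map_zero]

theorem opTensor_mul (P P' : H →L[ℂ] H) (Q Q' : K →L[ℂ] K) :
    opTensor (P * P') (Q * Q') = opTensor P Q * opTensor P' Q' :=
  HilbertTensor.clm_ext fun x y ↦ by simp only [mul_apply_eq_comp, opTensor_tmul]

theorem opTensor_one : opTensor (1 : H →L[ℂ] H) (1 : K →L[ℂ] K) = 1 :=
  HilbertTensor.clm_ext fun x y ↦ by simp only [opTensor_tmul, one_apply_eq_self]

theorem opTensor_add_left (P P' : H →L[ℂ] H) (Q : K →L[ℂ] K) :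
    opTensor (P + P') Q = opTensor P Q + opTensor P' Q :=
  HilbertTensor.clm_ext fun x y ↦ by
    simp only [add_apply, opTensor_tmul, HilbertTensor.add_tmul]

theorem opTensor_add_right (P : H →L[ℂ] H) (Q Q' : K →L[ℂ] K) :
    opTensor P (Q + Q') = opTensor P Q + opTensor P Q' :=
  HilbertTensor.clm_ext fun x y ↦ by
    simp only [add_apply, opTensor_tmul, HilbertTensor.tmul_add]

theorem opTensor_smul_left (c : ℂ) (P : H →L[ℂ] H) (Q : K →L[ℂ] K) :
    opTensor (c • P) Q = c • opTensor P Q :=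
  HilbertTensor.clm_ext fun x y ↦ by
    simp only [smul_apply, opTensor_tmul, HilbertTensor.smul_tmul]

theorem opTensor_smul_right (c : ℂ) (P : H →L[ℂ] H) (Q : K →L[ℂ] K) :
    opTensor P (c • Q) = c • opTensor P Q :=
  HilbertTensor.clm_ext fun x y ↦ by
    simp only [smul_apply, opTensor_tmul, HilbertTensor.tmul_smul]

variable [CompleteSpace H] [CompleteSpace K]

theorem star_opTensor (P : H →L[ℂ] H) (Q : K →L[ℂ] K) :
    star (opTensor P Q) = opTensor (star P) (star Q) :=
  HilbertTensor.clm_ext fun x y ↦ HilbertTensor.ext_inner_tmul fun x' y' ↦ by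
    simp only [ContinuousLinearMap.star_eq_adjoint, ContinuousLinearMap.adjoint_inner_left,
      opTensor_tmul, HilbertTensor.inner_tmul]

/-- The ampliation `P ↦ P ⊗ 1`. -/
noncomputable def ampliationLeft (H K : Type*) [NormedAddCommGroup H] [InnerProductSpace ℂ H]
    [NormedAddCommGroup K] [InnerProductSpace ℂ K] [CompleteSpace H] [CompleteSpace K] :
    (H →L[ℂ] H) →⋆ₙₐ[ℂ] (HilbertTensor H K →L[ℂ] HilbertTensor H K) where
  toFun P := opTensor P 1
  map_smul' c P := opTensor_smul_left c P 1
  map_zero' := by simpa only [zero_smul] using opTensor_smul_left 0 (0 : H →L[ℂ] H) 1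
  map_add' P P' := opTensor_add_left P P' 1
  map_mul' P P' := by rw [← opTensor_mul, one_mul]
  map_star' P := by rw [star_opTensor, star_one]

/-- The ampliation `Q ↦ 1 ⊗ Q`. -/
noncomputable def ampliationRight (H K : Type*) [NormedAddCommGroup H] [InnerProductSpace ℂ H]
    [NormedAddCommGroup K] [InnerProductSpace ℂ K] [CompleteSpace H] [CompleteSpace K] :
    (K →L[ℂ] K) →⋆ₙₐ[ℂ] (HilbertTensor H K →L[ℂ] HilbertTensor H K) where
  toFun Q := opTensor 1 Q
  map_smul' c Q := opTensor_smul_right c 1 Q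
  map_zero' := by simpa only [zero_smul] using opTensor_smul_right 0 1 (0 : K →L[ℂ] K)
  map_add' Q Q' := opTensor_add_right 1 Q Q'
  map_mul' Q Q' := by rw [← opTensor_mul, one_mul]
  map_star' Q := by rw [star_opTensor, star_one]

end HilbertTensor

section Slice

variable {H K : Type*} [NormedAddCommGroup H] [InnerProductSpace ℂ H]
  [NormedAddCommGroup K] [InnerProductSpace ℂ K] [CompleteSpace K]

/-- The slice map `T ↦ (x' ⊗ ·)† T (x ⊗ ·)`, that is `id_{B(K)}` tensored with the vector functional
`P ↦ ⟪x', P x⟫` on `B(H)`. -/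
noncomputable def slice (x' x : H) :
    (HilbertTensor H K →L[ℂ] HilbertTensor H K) →L[ℂ] K →L[ℂ] K :=
  ContinuousLinearMap.compL ℂ K (HilbertTensor H K) K (tensorLeft H K x').adjoint ∘L
    (ContinuousLinearMap.compL ℂ K (HilbertTensor H K) (HilbertTensor H K)).flip
      (tensorLeft H K x)

variable {T : HilbertTensor H K →L[ℂ] HilbertTensor H K}

theorem slice_apply (x' x : H) (T : HilbertTensor H K →L[ℂ] HilbertTensor H K) :
    slice x' x T = (tensorLeft H K x').adjoint ∘L (T ∘L tensorLeft H K x) := rfl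

theorem inner_slice (x' x : H) (T : HilbertTensor H K →L[ℂ] HilbertTensor H K) (y' y : K) :
    inner ℂ y' (slice x' x T y) =
      inner ℂ (HilbertTensor.tmul x' y') (T (HilbertTensor.tmul x y)) := by
  rw [slice_apply, ContinuousLinearMap.comp_apply, ContinuousLinearMap.adjoint_inner_right]
  rfl

theorem slice_opTensor (x' x : H) (P : H →L[ℂ] H) (Q : K →L[ℂ] K) :
    slice x' x (opTensor P Q) = inner ℂ x' (P x) • Q := by
  ext1 y
  refine ext_inner_left ℂ fun y' ↦ ?_
  rw [inner_slice, opTensor_tmul, HilbertTensor.inner_tmul, smul_apply, inner_smul_right]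

theorem slice_star_mul_self (x : H) (T : HilbertTensor H K →L[ℂ] HilbertTensor H K) :
    slice x x (star T * T) = (T ∘L tensorLeft H K x).adjoint ∘L (T ∘L tensorLeft H K x) := by
  rw [slice_apply, ContinuousLinearMap.adjoint_comp]
  rfl

theorem slice_star_mul_self_nonneg (x : H) (T : HilbertTensor H K →L[ℂ] HilbertTensor H K) :
    0 ≤ slice x x (star T * T) := by
  rw [slice_star_mul_self, ContinuousLinearMap.nonneg_iff_isPositive]
  exact ContinuousLinearMap.isPositive_adjoint_comp_self _

theorem eq_zero_of_slice_star_mul_self_eq_zero (h : ∀ x, slice x x (star T * T) = 0) : T = 0 :=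
  HilbertTensor.clm_ext fun x y ↦ by
    have hcomp := h x
    rw [slice_star_mul_self, ContinuousLinearMap.adjoint_comp_self_eq_zero_iff] at hcomp
    exact DFunLike.congr_fun hcomp y

end Slice

/-! ### Minimal tensor products -/

section RightSlice

variable {H K : Type*} [NormedAddCommGroup H] [InnerProductSpace ℂ H]
  [NormedAddCommGroup K] [InnerProductSpace ℂ K] [CompleteSpace K]

/-- The sesquilinear form `(x', x) ↦ ψ (slice x' x T)`, as a bounded linear function of `T`. -/
noncomputable def sliceForm (ψ : (K →L[ℂ] K) →L[ℂ] ℂ) :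
    (HilbertTensor H K →L[ℂ] HilbertTensor H K) →L[ℂ] H →L⋆[ℂ] StrongDual ℂ H :=
  let adj : (K →L[ℂ] HilbertTensor H K) ≃ₗᵢ⋆[ℂ] _ := ContinuousLinearMap.adjoint
  let postAdjoint : H →L⋆[ℂ] (K →L[ℂ] HilbertTensor H K) →L[ℂ] ℂ :=
    (.compL ℂ _ _ _ ψ ∘L .compL ℂ _ _ _).comp
      (adj.toContinuousLinearEquiv.toContinuousLinearMap.comp (tensorLeft H K))
  let pre : (HilbertTensor H K →L[ℂ] HilbertTensor H K) →L[ℂ] H →L[ℂ] K →L[ℂ] HilbertTensor H K :=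
    (ContinuousLinearMap.compL ℂ H (K →L[ℂ] HilbertTensor H K) (K →L[ℂ] HilbertTensor H K)).flip
      (tensorLeft H K) ∘L .compL ℂ K (HilbertTensor H K) (HilbertTensor H K)
  ((ContinuousLinearMap.compL ℂ H (K →L[ℂ] HilbertTensor H K) ℂ).bilinearComp postAdjoint pre).flip

theorem sliceForm_apply (ψ : (K →L[ℂ] K) →L[ℂ] ℂ)
    (T : HilbertTensor H K →L[ℂ] HilbertTensor H K) (x' x : H) :
    sliceForm ψ T x' x = ψ (slice x' x T) := rfl

variable [CompleteSpace H]

/-- The slice map `id_{B(H)} ⊗ ψ` of a functional `ψ` on `B(K)`. -/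
noncomputable def rightSlice (ψ : (K →L[ℂ] K) →L[ℂ] ℂ) :
    (HilbertTensor H K →L[ℂ] HilbertTensor H K) →L[ℂ] H →L[ℂ] H :=
  let adj : (H →L[ℂ] H) ≃ₗᵢ⋆[ℂ] (H →L[ℂ] H) := ContinuousLinearMap.adjoint
  let riesz := (InnerProductSpace.toDual ℂ H).symm.toContinuousLinearEquiv.toContinuousLinearMap
  (adj.toContinuousLinearEquiv.toContinuousLinearMap.comp (.compSL _ _ _ _ _ riesz)).comp
    (sliceForm ψ)

theorem inner_rightSlice (ψ : (K →L[ℂ] K) →L[ℂ] ℂ)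
    (T : HilbertTensor H K →L[ℂ] HilbertTensor H K) (x' x : H) :
    inner ℂ x' (rightSlice ψ T x) = ψ (slice x' x T) :=
  (ContinuousLinearMap.adjoint_inner_right _ _ _).trans
    (InnerProductSpace.toDual_symm_apply.trans (sliceForm_apply ψ T x' x))

theorem rightSlice_opTensor (ψ : (K →L[ℂ] K) →L[ℂ] ℂ) (P : H →L[ℂ] H) (Q : K →L[ℂ] K) :
    rightSlice ψ (opTensor P Q) = ψ Q • P := by
  ext1 x
  refine ext_inner_left ℂ fun x' ↦ ?_
  rw [inner_rightSlice, slice_opTensor, map_smul, smul_apply, inner_smul_right, smul_eq_mul,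
    mul_comm]

end RightSlice

section StarHom

variable {A D : Type*} [CStarAlgebra A] [CStarAlgebra D] {π : A →⋆ₐ[ℂ] D}

theorem isClosed_range_of_injective (hπ : Function.Injective π) :
    IsClosed (LinearMap.range π.toAlgHom.toLinearMap : Set D) :=
  (NonUnitalStarAlgHom.isometry π hπ).isClosedEmbedding.isClosed_range

theorem exists_eq_star_mul_self_of_map_nonneg [PartialOrder D] [StarOrderedRing D]
    (hπ : Function.Injective π) {a : A} (ha : 0 ≤ π a) : ∃ c, a = star c * c := by
  let _ := CStarAlgebra.spectralOrder A
  have := CStarAlgebra.spectralOrderedRing A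
  have hsa : IsSelfAdjoint a := hπ (by rw [map_star, (IsSelfAdjoint.of_nonneg ha).star_eq])
  refine CStarAlgebra.nonneg_iff_eq_star_mul_self.1
    ((StarOrderedRing.nonneg_iff_spectrum_nonneg (R := ℝ) a).2 fun t ht ↦ ?_)
  rw [← hsa.map_spectrum_real π hπ] at ht
  exact spectrum_nonneg_of_nonneg ha ht

end StarHom

section MinTensor

variable {A B H K : Type*} [CStarAlgebra A] [CStarAlgebra B]
  [NormedAddCommGroup H] [InnerProductSpace ℂ H] [CompleteSpace H]
  [NormedAddCommGroup K] [InnerProductSpace ℂ K] [CompleteSpace K]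
  {π : A →⋆ₐ[ℂ] (H →L[ℂ] H)} {σ : B →⋆ₐ[ℂ] (K →L[ℂ] K)}
  {S T : HilbertTensor H K →L[ℂ] HilbertTensor H K}

variable (π σ) in
/-- The elementary tensors `π a ⊗ σ b`. -/
def elementaryTensors : Submonoid (HilbertTensor H K →L[ℂ] HilbertTensor H K) where
  carrier := {T | ∃ (a : A) (b : B), T = opTensor (π a) (σ b)}
  one_mem' := ⟨1, 1, by rw [map_one, map_one, opTensor_one]⟩
  mul_mem' := by
    rintro _ _ ⟨a, b, rfl⟩ ⟨c, d, rfl⟩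
    exact ⟨a * c, b * d, by rw [map_mul, map_mul, opTensor_mul]⟩

theorem star_elementaryTensors :
    star (elementaryTensors π σ : Set (HilbertTensor H K →L[ℂ] HilbertTensor H K)) ⊆
      elementaryTensors π σ := by
  rintro T ⟨a, b, hT⟩
  exact ⟨star a, star b, by rw [map_star, map_star, ← star_opTensor, ← hT, star_star]⟩

theorem opTensor_mem_minTensor (a : A) (b : B) : opTensor (π a) (σ b) ∈ minTensor π σ :=
  StarSubalgebra.le_topologicalClosure _ (StarAlgebra.subset_adjoin ℂ _ ⟨a, b, rfl⟩)

theorem mem_of_mem_minTensor {p : Submodule ℂ (HilbertTensor H K →L[ℂ] HilbertTensor H K)}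
    (hp : IsClosed (p : Set (HilbertTensor H K →L[ℂ] HilbertTensor H K)))
    (h : ∀ a b, opTensor (π a) (σ b) ∈ p) (hT : T ∈ minTensor π σ) : T ∈ p := by
  refine closure_minimal (fun S hS ↦ ?_) hp hT
  have hspan := (StarAlgebra.adjoin_eq_span (R := ℂ) (elementaryTensors π σ :
    Set (HilbertTensor H K →L[ℂ] HilbertTensor H K))).le hS
  rw [Set.union_eq_left.2 star_elementaryTensors, Submonoid.closure_eq] at hspan
  refine Submodule.span_le.2 ?_ hspan
  rintro _ ⟨a, b, rfl⟩
  exact h a b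

theorem slice_mem_range (hσ : Function.Injective σ) (x' x : H) (hT : T ∈ minTensor π σ) :
    slice x' x T ∈ Set.range σ := by
  have hclosed := (isClosed_range_of_injective hσ).preimage (slice (K := K) x' x).continuous
  refine mem_of_mem_minTensor (p := (LinearMap.range σ.toAlgHom.toLinearMap).comap
    (slice x' x).toLinearMap) hclosed (fun a b ↦ ⟨inner ℂ x' (π a x) • b, ?_⟩) hT
  exact (map_smul σ _ _).trans (slice_opTensor _ _ _ _).symm

theorem rightSlice_mem_range (hπ : Function.Injective π) (ψ : (K →L[ℂ] K) →L[ℂ] ℂ)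
    (hT : T ∈ minTensor π σ) : rightSlice ψ T ∈ Set.range π := by
  have hclosed := (isClosed_range_of_injective hπ).preimage (rightSlice (H := H) ψ).continuous
  refine mem_of_mem_minTensor (p := (LinearMap.range π.toAlgHom.toLinearMap).comap
    (rightSlice ψ).toLinearMap) hclosed (fun a b ↦ ⟨ψ (σ b) • a, ?_⟩) hT
  exact (map_smul π _ _).trans (rightSlice_opTensor _ _ _).symm

theorem apply_mul_comm_of_mem_minTensor
    {ω : (HilbertTensor H K →L[ℂ] HilbertTensor H K) →L[ℂ] ℂ}
    (h : ∀ a b c d, ω (opTensor (π a) (σ b) * opTensor (π c) (σ d)) =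
      ω (opTensor (π c) (σ d) * opTensor (π a) (σ b)))
    (hS : S ∈ minTensor π σ) (hT : T ∈ minTensor π σ) : ω (S * T) = ω (T * S) := by
  let M := ContinuousLinearMap.mul ℂ (HilbertTensor H K →L[ℂ] HilbertTensor H K)
  have commutes_of_elementary : ∀ R : HilbertTensor H K →L[ℂ] HilbertTensor H K,
      (∀ a b, ω (R * opTensor (π a) (σ b)) = ω (opTensor (π a) (σ b) * R)) →
      ∀ T ∈ minTensor π σ, ω (R * T) = ω (T * R) := fun R hR T hT ↦
    sub_eq_zero.1 <| mem_of_mem_minTensor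
      (p := LinearMap.ker (ω ∘L M R - ω ∘L M.flip R).toLinearMap)
      (ContinuousLinearMap.isClosed_ker _) (fun a b ↦ sub_eq_zero.2 (hR a b)) hT
  exact commutes_of_elementary S
    (fun a b ↦ (commutes_of_elementary _ (fun c d ↦ h a b c d) S hS).symm) T hT

section ProductTrace

variable {φ : (H →L[ℂ] H) →L[ℂ] ℂ} {ψ : (K →L[ℂ] K) →L[ℂ] ℂ}

theorem exists_slice_star_mul_self_eq (hσ : Function.Injective σ) (x : H)
    (hT : T ∈ minTensor π σ) : ∃ b, slice x x (star T * T) = σ (star b * b) := by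
  obtain ⟨b, hb⟩ := slice_mem_range hσ x x (mul_mem (star_mem hT) hT)
  obtain ⟨c, rfl⟩ := exists_eq_star_mul_self_of_map_nonneg hσ
    (hb ▸ slice_star_mul_self_nonneg x T)
  exact ⟨c, hb.symm⟩

theorem rightSlice_star_mul_self_nonneg (hσ : Function.Injective σ)
    (hψ : ∀ b, 0 ≤ ψ (σ (star b * b))) (hT : T ∈ minTensor π σ) :
    0 ≤ rightSlice ψ (star T * T) := by
  refine (ContinuousLinearMap.nonneg_iff_isPositive _).2
    ((ContinuousLinearMap.isPositive_iff_complex _).2 fun x ↦ ?_)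
  obtain ⟨b, hb⟩ := exists_slice_star_mul_self_eq hσ x hT
  have hinner : 0 ≤ inner ℂ (rightSlice ψ (star T * T) x) x := by
    rw [← inner_conj_symm, inner_rightSlice, hb]
    exact star_nonneg_iff.2 (hψ b)
  exact ⟨Complex.ext rfl (RCLike.nonneg_iff.1 hinner).2.symm, (RCLike.nonneg_iff.1 hinner).1⟩

theorem exists_rightSlice_star_mul_self_eq (hπ : Function.Injective π)
    (hσ : Function.Injective σ) (hψ : ∀ b, 0 ≤ ψ (σ (star b * b))) (hT : T ∈ minTensor π σ) :
    ∃ a, rightSlice ψ (star T * T) = π (star a * a) := by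
  obtain ⟨a, ha⟩ := rightSlice_mem_range hπ ψ (mul_mem (star_mem hT) hT)
  obtain ⟨c, rfl⟩ := exists_eq_star_mul_self_of_map_nonneg hπ
    (ha ▸ rightSlice_star_mul_self_nonneg hσ hψ hT)
  exact ⟨c, ha.symm⟩

theorem eq_zero_of_rightSlice_star_mul_self_eq_zero (hσ : Function.Injective σ)
    (hψ : ∀ b, ψ (σ (star b * b)) = 0 → b = 0) (hT : T ∈ minTensor π σ)
    (hzero : rightSlice ψ (star T * T) = 0) : T = 0 := by
  refine eq_zero_of_slice_star_mul_self_eq_zero fun x ↦ ?_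
  obtain ⟨b, hb⟩ := exists_slice_star_mul_self_eq hσ x hT
  have hψb : ψ (σ (star b * b)) = 0 := by
    rw [← hb, ← inner_rightSlice, hzero, zero_apply, inner_zero_right]
  exact hb.trans (by rw [hψ b hψb, mul_zero, map_zero])

variable (π σ φ ψ) in
/-- The product functional `φ ⊗ ψ` on the minimal tensor product. -/
noncomputable def productFunctional : minTensor π σ →L[ℂ] ℂ :=
  φ ∘L rightSlice ψ ∘L (minTensor π σ).toSubalgebra.toSubmodule.subtypeL

theorem isBoundedTrace_productFunctional (hπ : Function.Injective π) (hσ : Function.Injective σ)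
    (hφ : IsBoundedTrace (φ ∘L starHomCLM (π : A →⋆ₙₐ[ℂ] H →L[ℂ] H)))
    (hψ : IsBoundedTrace (ψ ∘L starHomCLM (σ : B →⋆ₙₐ[ℂ] K →L[ℂ] K))) :
    IsBoundedTrace (productFunctional π σ φ ψ) := by
  refine isBoundedTrace_iff.2 ⟨fun T ↦ ?_, fun T ↦ ?_⟩
  · obtain ⟨a, ha⟩ := exists_rightSlice_star_mul_self_eq hπ hσ hψ.star_mul_self_nonneg T.2
    exact (congrArg φ ha).symm ▸ hφ.star_mul_self_nonneg a
  · have happly : ∀ a b c d, φ (rightSlice ψ (opTensor (π a) (σ b) * opTensor (π c) (σ d))) =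
        ψ (σ (b * d)) * φ (π (a * c)) := fun a b c d ↦ by
      rw [← opTensor_mul, ← map_mul, ← map_mul, rightSlice_opTensor, map_smul, smul_eq_mul]
    refine apply_mul_comm_of_mem_minTensor (ω := φ ∘L rightSlice ψ) (fun a b c d ↦ ?_)
      (star T).2 T.2
    exact (happly a b c d).trans <| (congrArg₂ _ (hψ.mul_comm b d) (hφ.mul_comm a c)).trans
      (happly c d a b).symm

theorem isFaithful_productFunctional (hπ : Function.Injective π) (hσ : Function.Injective σ)
    (hφ : IsFaithful (φ ∘L starHomCLM (π : A →⋆ₙₐ[ℂ] H →L[ℂ] H)))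
    (hψ : IsBoundedTrace (ψ ∘L starHomCLM (σ : B →⋆ₙₐ[ℂ] K →L[ℂ] K)))
    (hψf : IsFaithful (ψ ∘L starHomCLM (σ : B →⋆ₙₐ[ℂ] K →L[ℂ] K))) :
    IsFaithful (productFunctional π σ φ ψ) := by
  intro T hT
  obtain ⟨a, ha⟩ := exists_rightSlice_star_mul_self_eq hπ hσ hψ.star_mul_self_nonneg T.2
  refine Subtype.ext (eq_zero_of_rightSlice_star_mul_self_eq_zero hσ hψf T.2 (ha.trans ?_))
  rw [hφ a ((congrArg φ ha).symm.trans hT), mul_zero, map_zero]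

theorem hasFaithfulBoundedTrace_minTensor (hπ : Function.Injective π)
    (hσ : Function.Injective σ) (hA : HasFaithfulBoundedTrace A)
    (hB : HasFaithfulBoundedTrace B) : HasFaithfulBoundedTrace (minTensor π σ) := by
  obtain ⟨τ, hτ, hτf⟩ := hA
  obtain ⟨ρ, hρ, hρf⟩ := hB
  obtain ⟨φ, rfl⟩ : ∃ φ, φ ∘L starHomCLM (π : A →⋆ₙₐ[ℂ] H →L[ℂ] H) = τ :=
    (exists_extension_of_injective (f := (π : A →⋆ₙₐ[ℂ] H →L[ℂ] H)) hπ τ).imp fun _ ↦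
      ContinuousLinearMap.ext
  obtain ⟨ψ, rfl⟩ : ∃ ψ, ψ ∘L starHomCLM (σ : B →⋆ₙₐ[ℂ] K →L[ℂ] K) = ρ :=
    (exists_extension_of_injective (f := (σ : B →⋆ₙₐ[ℂ] K →L[ℂ] K)) hσ ρ).imp fun _ ↦
      ContinuousLinearMap.ext
  exact ⟨productFunctional π σ φ ψ, isBoundedTrace_productFunctional hπ hσ hτ hρ,
    isFaithful_productFunctional hπ hσ hτf hρ hρf⟩

end ProductTrace

variable (π σ) in
/-- The embedding `a ↦ a ⊗ 1` into the minimal tensor product. -/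
noncomputable def inclLeft : A →⋆ₙₐ[ℂ] minTensor π σ :=
  NonUnitalStarAlgHom.codRestrict ((ampliationLeft H K).comp (π : A →⋆ₙₐ[ℂ] H →L[ℂ] H))
    (minTensor π σ).toNonUnitalStarSubalgebra fun a ↦ by
      have h := opTensor_mem_minTensor (π := π) (σ := σ) a 1
      rwa [map_one] at h

variable (π σ) in
/-- The embedding `b ↦ 1 ⊗ b` into the minimal tensor product. -/
noncomputable def inclRight : B →⋆ₙₐ[ℂ] minTensor π σ :=
  NonUnitalStarAlgHom.codRestrict ((ampliationRight H K).comp (σ : B →⋆ₙₐ[ℂ] K →L[ℂ] K))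
    (minTensor π σ).toNonUnitalStarSubalgebra fun b ↦ by
      have h := opTensor_mem_minTensor (π := π) (σ := σ) 1 b
      rwa [map_one] at h

theorem ampliationLeft_injective [Nontrivial K] : Function.Injective (ampliationLeft H K) := by
  refine (injective_iff_map_eq_zero _).2 fun P hP ↦ ContinuousLinearMap.ext fun x ↦ ?_
  have hslice : inner ℂ (P x) (P x) • (1 : K →L[ℂ] K) = 0 := by
    rw [← slice_opTensor]
    exact (congrArg (slice (P x) x) hP).trans (map_zero _)
  exact inner_self_eq_zero.1 ((smul_eq_zero_iff_left one_ne_zero).1 hslice)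

theorem ampliationRight_injective [Nontrivial H] : Function.Injective (ampliationRight H K) := by
  refine (injective_iff_map_eq_zero _).2 fun Q hQ ↦ ?_
  obtain ⟨x, hx⟩ := exists_ne (0 : H)
  have hslice : inner ℂ x ((1 : H →L[ℂ] H) x) • Q = 0 := by
    rw [← slice_opTensor]
    exact (congrArg (slice x x) hQ).trans (map_zero _)
  exact (smul_eq_zero_iff_right (inner_self_ne_zero.2 hx)).1 hslice

theorem inclLeft_injective [Nontrivial K] (hπ : Function.Injective π) :
    Function.Injective (inclLeft π σ) := fun _ _ h ↦
  hπ (ampliationLeft_injective (congrArg Subtype.val h))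

theorem inclRight_injective [Nontrivial H] (hσ : Function.Injective σ) :
    Function.Injective (inclRight π σ) := fun _ _ h ↦
  hσ (ampliationRight_injective (congrArg Subtype.val h))

theorem nontrivial_of_injective [Nontrivial A] (hπ : Function.Injective π) : Nontrivial H := by
  by_contra! hH
  exact not_subsingleton A (hπ.subsingleton)

theorem nontrivial_hilbertTensor [Nontrivial (minTensor π σ)] :
    Nontrivial (HilbertTensor H K) := by
  have := (minTensor π σ).subtype_injective.nontrivial
  by_contra! hHK
  exact not_subsingleton (HilbertTensor H K →L[ℂ] HilbertTensor H K) inferInstance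

theorem hasFaithfulTrace_minTensor_iff (hπ : Function.Injective π) (hσ : Function.Injective σ) :
    HasFaithfulTrace (minTensor π σ) ↔ HasFaithfulTrace A ∧ HasFaithfulTrace B := by
  simp only [hasFaithfulTrace_iff]
  constructor
  · rintro ⟨_, h⟩
    have := nontrivial_hilbertTensor (π := π) (σ := σ)
    have := HilbertTensor.nontrivial_left (H := H) (K := K)
    have := HilbertTensor.nontrivial_right (H := H) (K := K)
    exact ⟨⟨π.toRingHom.domain_nontrivial, h.comap (inclLeft_injective hπ)⟩,
      ⟨σ.toRingHom.domain_nontrivial, h.comap (inclRight_injective hσ)⟩⟩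
  · rintro ⟨⟨_, hA⟩, ⟨_, hB⟩⟩
    have := nontrivial_of_injective hσ
    exact ⟨(inclLeft_injective hπ).nontrivial, hasFaithfulBoundedTrace_minTensor hπ hσ hA hB⟩

end MinTensor

end CStarTrace

theorem proposition6p4 {A : Type*} {B : Type*} [CStarAlgebra A] [CStarAlgebra B] :
    -- (i) Morita equivalence
    (CStarTrace.MoritaEquivalent A B →
      CStarTrace.HasFaithfulTrace A → CStarTrace.HasFaithfulTrace B) ∧
    -- (ii) minimal tensor products, in arbitrary faithful representations
    (∀ {H : Type*} [NormedAddCommGroup H] [InnerProductSpace ℂ H] [CompleteSpace H]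
      {K : Type*} [NormedAddCommGroup K] [InnerProductSpace ℂ K] [CompleteSpace K]
      (π : A →⋆ₐ[ℂ] (H →L[ℂ] H)) (σ : B →⋆ₐ[ℂ] (K →L[ℂ] K)),
      Function.Injective π → Function.Injective σ →
      (CStarTrace.HasFaithfulTrace (CStarTrace.minTensor π σ) ↔
        CStarTrace.HasFaithfulTrace A ∧ CStarTrace.HasFaithfulTrace B)) ∧
    -- (iii) essential ideals
    (Nontrivial A → ∀ (I : Ideal A) [I.IsTwoSided] [IsClosed (I : Set A)],
      CStarTrace.IsEssential I → CStarTrace.HasFaithfulBoundedTrace (CStarTrace.idealAlgebra I) →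
      CStarTrace.HasFaithfulTrace A) ∧
    -- (iii) multiplier algebras
    (∀ (J : Type*) [NonUnitalCStarAlgebra J],
      CStarTrace.HasFaithfulTrace J ↔ CStarTrace.HasFaithfulTrace 𝓜(ℂ, J)) ∧
    -- (iv) ideals and quotients
    (∀ (I : Ideal A) [I.IsTwoSided] [IsClosed (I : Set A)],
      CStarTrace.HasFaithfulTrace (CStarTrace.idealAlgebra I) →
      CStarTrace.HasFaithfulTrace (A ⧸ I) → CStarTrace.HasFaithfulTrace A) := by
  refine ⟨CStarTrace.MoritaEquivalent.hasFaithfulTrace, ?tensor, ?essential, ?multiplier, ?quotient⟩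
  case tensor => exact fun _ _ hπ hσ ↦ CStarTrace.hasFaithfulTrace_minTensor_iff hπ hσ
  case essential => exact fun _ _ _ _ hI h ↦ hI.hasFaithfulTrace h
  case multiplier => exact fun _ _ ↦ CStarTrace.hasFaithfulTrace_multiplier_iff
  case quotient => exact fun _ _ _ hI hQ ↦ CStarTrace.hasFaithfulTrace_of_quotient hI hQ
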